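/- Let $K>1$, $\alpha>0$ and $\kappa\in(0,1)$. There is a constant $C>0$, depending only on $K$, $\alpha$ and $\kappa$, such that the following holds. Let $Y=f+\varepsilon$, where $f\in\mathbb R^n$ and the $\varepsilon_i$ are independent centered Gaussian variables with common variance $\sigma^2>0$. Let $\mathbb S$ be a finite or countable family of linear subspaces of $\mathbb R^n$ with $\dim(S)\le n-2$ for all $S\in\mathbb S$, and let $\Delta:\mathbb S\to\mathbb R_+$ be such that $\Sigma=\sum_{S\in\mathbb S}e^{-\Delta(S)}<+\infty$ and $1\le \dim(S)\vee\Delta(S)\le\kappa n$ for all $S\in\mathbb S$. Let $\mathrm{pen}(S)=K\,\mathrm{pen}_\Delta(S)$, where $\mathrm{pen}_\Delta(S)\ge 0$ is the solution of $$\mathbb E\Big[\Big(U-\frac{\mathrm{pen}_\Delta(S)}{n-\dim(S)}V\Big)_+\Big]=e^{-\Delta(S)},$$ $U$ and $V$ being independent $\chi^2$ variables with $\dim(S)+1$ and $n-\dim(S)-1$ degrees of freedom. Let $\{\widehat f_\lambda,\ \lambda\in\Lambda\}$ be an arbitrary collection of estimators of $f$ (random vectors of $\mathbb R^n$) and, for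 each $\lambda\in\Lambda$, let $\mathbb S_\lambda\subset\mathbb S$ be a (possibly random) subset. Assume that for each $\lambda\in\Lambda$ there is a (possibly random) linear space $\widehat S_\lambda\in\mathbb S_\lambda$ such that $\widehat f_\lambda\in\widehat S_\lambda$ with probability $1$. With $\Pi_S$ the orthogonal projection onto $S$ and $\widehat\sigma_S^2=\|Y-\Pi_SY\|^2/(n-\dim(S))$, let $$\mathrm{crit}_\alpha(\widehat f_\lambda)=\inf_{S\in\mathbb S_\lambda}\Big[\|Y-\Pi_S\widehat f_\lambda\|^2+\alpha\|\widehat f_\lambda-\Pi_S\widehat f_\lambda\|^2+\mathrm{pen}(S)\,\widehat\sigma_S^2\Big].$$ Let $\delta\ge 0$ and let $\widehat\lambda$ be a random element of $\Lambda$ such that $\mathrm{crit}_\alpha(\widehat f_{\widehat\lambda})\le\inf_{\lambda\in\Lambda}\mathrm{crit}_\alpha(\widehat f_\lambda)+\delta$ almost surely. Then $$\frac{C}{1+\Sigma}\,\mathbb E\big[\|f-\widehat f_{\widehat\lambda}\|^2\big]\le\inf_{\lambda\in\Lambda}\Big[\mathbb E\big[\|f-\widehat f_\lambda\|^2\big]+\mathbb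 E\big[\dim(\widehat S_\lambda)\vee\Delta(\widehat S_\lambda)\big]\sigma^2\Big]+\delta .$$ -/

import Mathlib

open MeasureTheory ProbabilityTheory
open scoped ENNReal

noncomputable section

namespace EstimatorSelection

/-- The `χ²` distribution with `k` degrees of freedom: the law of the sum of the squares of `k`
independent standard Gaussian variables. -/
def chiSquared (k : ℕ) : Measure ℝ :=
  (Measure.pi (fun _ : Fin k => gaussianReal 0 1)).map (fun z => ∑ i, z i ^ 2)

/-- `E [(U - x / (n - D) * V)₊]` where `U` and `V` are independent `χ²` variables with `D + 1` and
`n - D - 1` degrees of freedom respectively. -/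
def expectedExcess (n D : ℕ) (x : ℝ) : ℝ :=
  ∫ p : ℝ × ℝ, max (p.1 - x / ((n : ℝ) - D) * p.2) 0
    ∂((chiSquared (D + 1)).prod (chiSquared (n - D - 1)))

/-- The penalty `pen_Δ(S)`: for `D = dim S ≤ n - 2` and `w = Δ(S) ≥ 0`, the solution `x ≥ 0` of
`E [(U - x / (n - D) * V)₊] = exp (-w)`. The left-hand side is continuous and strictly decreasing
in `x ≥ 0`, from `D + 1 ≥ exp (-w)` to `0`, so that the set below has exactly one element. -/
def penDelta (n D : ℕ) (w : ℝ) : ℝ :=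
  sInf {x : ℝ | 0 ≤ x ∧ expectedExcess n D x = Real.exp (-w)}

/-- `dim(S) ∨ Δ(S)`. -/
def dimOrWeight {n : ℕ} (Δ : Submodule ℝ (EuclideanSpace ℝ (Fin n)) → ℝ)
    (S : Submodule ℝ (EuclideanSpace ℝ (Fin n))) : ℝ :=
  max (Module.finrank ℝ S : ℝ) (Δ S)

/-- The variance estimator `‖Y - Π_S Y‖² / (n - dim S)`, with `Π_S` the orthogonal projection. -/
def sigmaHatSq {n : ℕ} (S : Submodule ℝ (EuclideanSpace ℝ (Fin n)))
    (Y : EuclideanSpace ℝ (Fin n)) : ℝ :=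
  ‖Y - S.starProjection Y‖ ^ 2 / ((n : ℝ) - Module.finrank ℝ S)

/-- The criterion `crit_α(g)` of an estimate `g`, computed from the observation `Y` and the
collection `T` of linear spaces: the infimum over `S ∈ T` of
`‖Y - Π_S g‖² + α ‖g - Π_S g‖² + pen(S) σ̂²_S`. These quantities are nonnegative, and the infimum
is taken in `[0, ∞]`, so that it is `∞` when `T` is empty. -/
def crit {n : ℕ} (α : ℝ) (pen : Submodule ℝ (EuclideanSpace ℝ (Fin n)) → ℝ)
    (T : Set (Submodule ℝ (EuclideanSpace ℝ (Fin n))))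
    (Y g : EuclideanSpace ℝ (Fin n)) : ℝ≥0∞ :=
  ⨅ S ∈ T, ENNReal.ofReal
    (‖Y - S.starProjection g‖ ^ 2 + α * ‖g - S.starProjection g‖ ^ 2 + pen S * sigmaHatSq S Y)

end EstimatorSelection

end

/-! The argument is pathwise. To each `S` attach a space `T ⊇ S` containing `f`, of dimension `dim S
+ 1`. For any estimate `g`, `Π_S g - f` lies in `T`, so the cross term `2⟪ε, Π_S g - f⟫` in `‖Y -
Π_S g‖²` costs at most `K⁻¹‖Π_S g - f‖² + K‖Π_T ε‖²`. Up to an excess, `‖Π_T ε‖²` is at most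
`pen_Δ(S) σ̂²_S` (`sq_norm_starProjection_le`), and by the definition of the penalty this excess has
mean `σ² exp (-Δ S)` (`lintegral_noiseExcess`). Summing the excesses over the whole family handles
random spaces, at the price `K Σ σ²`.

This bounds the criterion of the selected estimator below and that of any competitor above
(`le_penalized_criterion`, `penalized_criterion_le`); `‖ε‖²` cancels between the two. It remains to
bound `pen_Δ(S) σ̂²_S` for the competitor: Laplace transforms give `pen_Δ(S) ≤ C(κ) (dim S ∨ Δ S)`
(`penDelta_spec`), and `σ̂²_S` is controlled by the loss and `‖ε‖²` (`residual_le`). -/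

namespace EstimatorSelection

/-! ### Moments and Laplace transforms of `χ²` laws. -/

lemma integral_exp_mul_sq_gaussianReal {t : ℝ} (ht : t < 1 / 2) :
    ∫ z, Real.exp (t * z ^ 2) ∂(gaussianReal 0 1) = √(1 / (1 - 2 * t)) := by
  rw [integral_gaussianReal_eq_integral_smul one_ne_zero]
  have h : ∀ z : ℝ, gaussianPDFReal 0 1 z • Real.exp (t * z ^ 2) =
      (√(2 * Real.pi))⁻¹ * Real.exp (-(1 / 2 - t) * z ^ 2) := by
    intro z
    simp only [gaussianPDFReal, smul_eq_mul, NNReal.coe_one, mul_one, sub_zero]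
    rw [mul_assoc, ← Real.exp_add]
    ring_nf
  simp_rw [h]
  rw [integral_const_mul, integral_gaussian, ← Real.sqrt_inv, ← Real.sqrt_mul (by positivity)]
  congr 1
  have : 1 - 2 * t ≠ 0 := by linarith
  have h2 : 1 / 2 - t ≠ 0 := by linarith
  field_simp

lemma measurable_sum_sq (k : ℕ) : Measurable (fun z : Fin k → ℝ => ∑ i, z i ^ 2) := by
  fun_prop

instance isProbabilityMeasure_chiSquared (k : ℕ) : IsProbabilityMeasure (chiSquared k) :=
  Measure.isProbabilityMeasure_map (measurable_sum_sq k).aemeasurable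

lemma integral_exp_mul_chiSquared {t : ℝ} (ht : t < 1 / 2) (k : ℕ) :
    ∫ u, Real.exp (t * u) ∂(chiSquared k) = √(1 / (1 - 2 * t)) ^ k := by
  rw [chiSquared, integral_map (measurable_sum_sq k).aemeasurable (by fun_prop)]
  simp_rw [Finset.mul_sum, Real.exp_sum]
  rw [integral_fintype_prod_eq_prod (fun (_ : Fin k) z => Real.exp (t * z ^ 2))]
  simp [integral_exp_mul_sq_gaussianReal ht]

lemma integrable_exp_mul_chiSquared {t : ℝ} (ht : t < 1 / 2) (k : ℕ) :
    Integrable (fun u => Real.exp (t * u)) (chiSquared k) := by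
  refine Integrable.of_integral_ne_zero ?_
  rw [integral_exp_mul_chiSquared ht]
  have : 0 < 1 - 2 * t := by linarith
  positivity

lemma integrable_sq_gaussianReal : Integrable (fun z : ℝ => z ^ 2) (gaussianReal 0 1) :=
  (memLp_id_gaussianReal 2).integrable_sq

lemma integral_sq_gaussianReal : ∫ z, z ^ 2 ∂(gaussianReal 0 1) = 1 := by
  have h := variance_id_gaussianReal (μ := 0) (v := 1)
  rw [variance_eq_sub (memLp_id_gaussianReal 2)] at h
  simpa using h

lemma integrable_eval_sq {k : ℕ} (i : Fin k) :
    Integrable (fun z : Fin k → ℝ => z i ^ 2) (Measure.pi fun _ => gaussianReal 0 1) :=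
  (measurePreserving_eval (fun _ : Fin k => gaussianReal 0 1) i).integrable_comp_of_integrable
    integrable_sq_gaussianReal

lemma integrable_id_chiSquared (k : ℕ) : Integrable (fun u => u) (chiSquared k) := by
  rw [chiSquared, integrable_map_measure (by fun_prop) (measurable_sum_sq k).aemeasurable]
  refine integrable_finsetSum _ fun i _ => ?_
  exact integrable_eval_sq i

lemma integral_id_chiSquared (k : ℕ) : ∫ u, u ∂(chiSquared k) = k := by
  rw [chiSquared, integral_map (measurable_sum_sq k).aemeasurable (by fun_prop), integral_finsetSum]
  · have h : ∀ i : Fin k, ∫ z : Fin k → ℝ, z i ^ 2 ∂(Measure.pi fun _ => gaussianReal 0 1) = 1 := by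
      intro i
      rw [integral_comp_eval (μ := fun _ : Fin k => gaussianReal 0 1) (f := fun z : ℝ => z ^ 2)
        (by fun_prop), integral_sq_gaussianReal]
    simp [h]
  · exact fun i _ => integrable_eval_sq i

lemma sqrt_two_le_exp_half : √2 ≤ Real.exp (1 / 2) := by
  rw [Real.sqrt_le_left (by positivity), ← Real.exp_nat_mul]
  have := Real.add_one_le_exp 1
  norm_num at this ⊢
  linarith

lemma max_zero_le_exp (y : ℝ) : max y 0 ≤ 4 * Real.exp (y / 4) := by
  refine max_le ?_ (by positivity)
  linarith [Real.add_one_le_exp (y / 4)]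

lemma integrable_excess (a : ℝ) (j k : ℕ) :
    Integrable (fun p : ℝ × ℝ => max (p.1 - a * p.2) 0) ((chiSquared j).prod (chiSquared k)) :=
  (((integrable_id_chiSquared j).comp_fst _).sub
    (((integrable_id_chiSquared k).comp_snd _).const_mul a)).pos_part

/-- Chernoff bound: `y₊ ≤ 4 exp (y / 4)`, and independence splits the exponential moment into two
Laplace transforms, at `1 / 4` and `-a / 4`. -/
lemma integral_excess_le {a : ℝ} (ha : 0 ≤ a) (j k : ℕ) :
    ∫ p : ℝ × ℝ, max (p.1 - a * p.2) 0 ∂((chiSquared j).prod (chiSquared k)) ≤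
      4 * (√2 ^ j * √(1 / (1 + a / 2)) ^ k) := by
  have h1 : (1 / 4 : ℝ) < 1 / 2 := by norm_num
  have h2 : -(a / 4) < 1 / 2 := by linarith
  calc _ ≤ ∫ p : ℝ × ℝ, 4 * (Real.exp (1 / 4 * p.1) * Real.exp (-(a / 4) * p.2))
        ∂((chiSquared j).prod (chiSquared k)) := by
        refine integral_mono (integrable_excess a j k)
          (((integrable_exp_mul_chiSquared h1 j).mul_prod
            (integrable_exp_mul_chiSquared h2 k)).const_mul 4) fun p => ?_
        refine (max_zero_le_exp _).trans_eq ?_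
        rw [← Real.exp_add]
        ring_nf
    _ = _ := by
        rw [integral_const_mul, integral_prod_mul (fun u => Real.exp (1 / 4 * u))
          (fun v => Real.exp (-(a / 4) * v)), integral_exp_mul_chiSquared h1,
          integral_exp_mul_chiSquared h2]
        congr 5 <;> norm_num
        ring

/-! ### Existence and size of the penalty. -/

lemma continuous_expectedExcess (n D : ℕ) : Continuous (expectedExcess n D) := by
  unfold expectedExcess
  set P := (chiSquared (D + 1)).prod (chiSquared (n - D - 1))
  refine continuous_iff_continuousAt.2 fun x₀ => ?_
  have hI : Integrable (fun p : ℝ × ℝ => |p.1| + (|x₀| + 1) / |(n : ℝ) - D| * |p.2|) P :=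
    ((integrable_id_chiSquared _).abs.comp_fst _).add
      (((integrable_id_chiSquared _).abs.comp_snd _).const_mul _)
  refine continuousAt_of_dominated (bound := fun p => |p.1| + (|x₀| + 1) / |(n : ℝ) - D| * |p.2|)
    (.of_forall fun x => by fun_prop) ?_ hI
    (.of_forall fun p => by fun_prop)
  filter_upwards [Metric.ball_mem_nhds x₀ one_pos] with x hx
  refine .of_forall fun p => ?_
  have hx' : |x| ≤ |x₀| + 1 := by
    rw [Metric.mem_ball, Real.dist_eq] at hx
    linarith [abs_sub_abs_le_abs_sub x x₀]
  rw [Real.norm_eq_abs, abs_of_nonneg (le_max_right _ _)]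
  refine max_le ?_ (by positivity)
  calc p.1 - x / ((n : ℝ) - D) * p.2 ≤ |p.1| + |x / ((n : ℝ) - D) * p.2| := by
        linarith [le_abs_self p.1, neg_abs_le (x / ((n : ℝ) - D) * p.2)]
    _ ≤ _ := by
        rw [abs_mul, abs_div]
        gcongr

lemma one_le_expectedExcess_zero (n D : ℕ) : 1 ≤ expectedExcess n D 0 := by
  have h : ∫ p : ℝ × ℝ, p.1 ∂((chiSquared (D + 1)).prod (chiSquared (n - D - 1))) = D + 1 := by
    rw [integral_fun_fst (f := fun u : ℝ => u), integral_id_chiSquared]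
    simp
  calc (1 : ℝ) ≤ D + 1 := by linarith [Nat.cast_nonneg (α := ℝ) D]
    _ = _ := h.symm
    _ ≤ _ := by
      unfold expectedExcess
      refine integral_mono ((integrable_id_chiSquared _).comp_fst _) (integrable_excess _ _ _)
        fun p => ?_
      simp

/-- A constant such that `pen_Δ(S) ≤ penConst κ * (dim S ∨ Δ S)` if `dim S ∨ Δ S ≤ κ n`. -/
noncomputable def penConst (κ : ℝ) : ℝ := 32 * Real.exp (8 * (2 * κ / (1 - κ)))

/-- By `integral_excess_le` it suffices that the Laplace transform of `V` beats `4 * √2 ^ (D + 1) *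
exp w`. As `dim ∨ Δ ≤ κ n`, the ratio of `M` to the degrees of freedom of `V` is bounded, so a
penalty linear in `M` is enough. -/
lemma expectedExcess_le_exp {κ w : ℝ} {n D : ℕ} (hκ : κ ∈ Set.Ioo (0 : ℝ) 1) (hD : D + 2 ≤ n)
    (h1 : 1 ≤ max (D : ℝ) w) (h2 : max (D : ℝ) w ≤ κ * n) :
    expectedExcess n D (penConst κ * max (D : ℝ) w) ≤ Real.exp (-w) := by
  obtain ⟨hκ0, hκ1⟩ := hκ
  -- `m + 1` is the number of degrees of freedom of `V`, and `n - D = m + 2`.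
  obtain ⟨m, rfl⟩ : ∃ m, n = D + (m + 1) + 1 := ⟨n - D - 2, by omega⟩
  set M := max (D : ℝ) w
  have hDM : (D : ℝ) ≤ M := le_max_left _ _
  have hwM : w ≤ M := le_max_right _ _
  have hm : (0 : ℝ) < m + 1 := by positivity
  have hN : ((D + (m + 1) + 1 : ℕ) : ℝ) - D = m + 2 := by push_cast; ring
  have hr : M / (m + 1) ≤ 2 * κ / (1 - κ) := by
    rw [div_le_div_iff₀ hm (by linarith)]
    have hDκ := hDM.trans h2
    push_cast at h2 hDκ
    nlinarith [Nat.cast_nonneg (α := ℝ) m]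
  have hC : 0 < penConst κ := by unfold penConst; positivity
  -- The exponent `8` yields a factor `exp (-4 M)` in the end, and `2 + (D + 1) / 2 - 4 M ≤ -w`
  -- since `D, w ≤ M` and `M ≥ 1`. The bound is `exp t ≤ 1 + t exp t`; the `32` in `penConst` is `8
  -- * 2 * 2`, one `2` coming from `m + 2 ≤ 2 (m + 1)`.
  have hexp : Real.exp (8 * (M / (m + 1))) ≤ 1 + penConst κ * M / (m + 2) / 2 := by
    set y := M / (m + 1) with hy
    have hy0 : 0 ≤ y := by positivity
    have e1 : Real.exp (8 * y) ≤ 1 + 8 * y * Real.exp (8 * y) := by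
      have := Real.add_one_le_exp (-(8 * y))
      have h3 : Real.exp (-(8 * y)) * Real.exp (8 * y) = 1 := by
        rw [← Real.exp_add]; simp
      nlinarith [Real.exp_pos (8 * y)]
    have e2 : 8 * y * Real.exp (8 * y) ≤ 8 * y * Real.exp (8 * (2 * κ / (1 - κ))) := by gcongr
    have e3 : 8 * y * Real.exp (8 * (2 * κ / (1 - κ))) = penConst κ * M / (2 * (m + 1)) / 2 := by
      rw [hy, penConst]; field_simp; norm_num
    have e4 : penConst κ * M / (2 * (m + 1)) / 2 ≤ penConst κ * M / (m + 2) / 2 := by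
      gcongr
      linarith [Nat.cast_nonneg (α := ℝ) m]
    linarith
  have hs2 := sqrt_two_le_exp_half
  have h4 : (4 : ℝ) ≤ Real.exp 2 := by
    have h := Real.add_one_le_exp 1
    have : Real.exp 2 = Real.exp 1 * Real.exp 1 := by rw [← Real.exp_add]; norm_num
    nlinarith
  have hs3 : √(1 / (1 + penConst κ * M / (m + 2) / 2)) ≤ Real.exp (-(4 * (M / (m + 1)))) := by
    rw [Real.sqrt_le_left (by positivity), ← Real.exp_nat_mul, one_div]
    refine (inv_anti₀ (Real.exp_pos _) hexp).trans_eq ?_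
    rw [← Real.exp_neg]
    congr 1; push_cast; ring
  unfold expectedExcess
  refine (integral_excess_le (by rw [hN]; positivity) _ _).trans ?_
  have hk : D + (m + 1) + 1 - D - 1 = m + 1 := by omega
  rw [hk, hN]
  calc 4 * (√2 ^ (D + 1) * √(1 / (1 + penConst κ * M / (m + 2) / 2)) ^ (m + 1))
      ≤ Real.exp 2 * (Real.exp (1 / 2) ^ (D + 1) * Real.exp (-(4 * (M / (m + 1)))) ^ (m + 1)) := by
        gcongr
    _ = Real.exp (2 + ((D + 1) / 2 - 4 * M)) := by
        rw [← Real.exp_nat_mul, ← Real.exp_nat_mul, ← Real.exp_add, ← Real.exp_add]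
        congr 1; push_cast; field_simp; ring
    _ ≤ Real.exp (-w) := by
        apply Real.exp_le_exp.2
        linarith

/-- The intermediate value theorem gives a solution below the bound; the solution set is closed, so
its infimum is itself a solution. Uniqueness is not needed. -/
lemma penDelta_spec {κ w : ℝ} {n D : ℕ} (hκ : κ ∈ Set.Ioo (0 : ℝ) 1) (hD : D + 2 ≤ n)
    (hw : 0 ≤ w) (h1 : 1 ≤ max (D : ℝ) w) (h2 : max (D : ℝ) w ≤ κ * n) :
    0 ≤ penDelta n D w ∧ penDelta n D w ≤ penConst κ * max (D : ℝ) w ∧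
      expectedExcess n D (penDelta n D w) = Real.exp (-w) := by
  have hC : 0 ≤ penConst κ := by unfold penConst; positivity
  have hcont := continuous_expectedExcess n D
  have hclosed : IsClosed {x : ℝ | 0 ≤ x ∧ expectedExcess n D x = Real.exp (-w)} :=
    (isClosed_le continuous_const continuous_id).inter (isClosed_eq hcont continuous_const)
  have hbdd : BddBelow {x : ℝ | 0 ≤ x ∧ expectedExcess n D x = Real.exp (-w)} :=
    ⟨0, fun _ hx => hx.1⟩
  obtain ⟨x, hx, hxe⟩ := intermediate_value_Icc' (a := 0) (b := penConst κ * max (D : ℝ) w)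
    (by positivity) hcont.continuousOn
    (show Real.exp (-w) ∈ _ from ⟨expectedExcess_le_exp hκ hD h1 h2,
      (Real.exp_le_one_iff.2 (by linarith)).trans (one_le_expectedExcess_zero n D)⟩)
  have hmem := hclosed.csInf_mem ⟨x, hx.1, hxe⟩ hbdd
  exact ⟨hmem.1, (csInf_le hbdd ⟨hx.1, hxe⟩).trans hx.2, hmem.2⟩

/-! ### Enlarged spaces and the splitting of a standard Gaussian vector. -/

section Geometry

variable {E : Type*} [NormedAddCommGroup E] [InnerProductSpace ℝ E] [FiniteDimensional ℝ E]

lemma exists_finrank_succ (S : Submodule ℝ E) (f : E)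
    (hS : Module.finrank ℝ S < Module.finrank ℝ E) :
    ∃ T : Submodule ℝ E, S ≤ T ∧ f ∈ T ∧ Module.finrank ℝ T = Module.finrank ℝ S + 1 := by
  obtain ⟨g, hg, hfg⟩ : ∃ g, g ∉ S ∧ f ∈ S ⊔ ℝ ∙ g := by
    by_cases hf : f ∈ S
    -- If `f ∈ S`, any outside vector is adjoined: the dimension must be exactly `dim S + 1` to
    -- match `U`.
    · have hne : S ≠ ⊤ := by rintro rfl; simp at hS
      obtain ⟨g, -, hg⟩ := SetLike.exists_of_lt hne.lt_top
      exact ⟨g, hg, Submodule.mem_sup_left hf⟩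
    · exact ⟨f, hf, Submodule.mem_sup_right (Submodule.mem_span_singleton_self f)⟩
  have hg0 : g ≠ 0 := fun h => hg (h ▸ S.zero_mem)
  refine ⟨S ⊔ ℝ ∙ g, le_sup_left, hfg, ?_⟩
  have h := Submodule.finrank_sup_add_finrank_inf_eq S (ℝ ∙ g)
  have hd : S ⊓ ℝ ∙ g = ⊥ := by
    rw [← disjoint_iff, Submodule.disjoint_span_singleton' hg0]
    exact hg
  rw [hd, finrank_bot, finrank_span_singleton hg0] at h
  exact h

/-- A linear space of dimension `dim S + 1` that contains `S` and `f`, if `S` is not the whole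
space. -/
noncomputable def extend (S : Submodule ℝ E) (f : E) : Submodule ℝ E :=
  open Classical in
  if h : Module.finrank ℝ S < Module.finrank ℝ E then (exists_finrank_succ S f h).choose else ⊤

lemma extend_spec {S : Submodule ℝ E} (f : E) (h : Module.finrank ℝ S < Module.finrank ℝ E) :
    S ≤ extend S f ∧ f ∈ extend S f ∧ Module.finrank ℝ (extend S f) = Module.finrank ℝ S + 1 := by
  rw [extend, dif_pos h]
  exact (exists_finrank_succ S f h).choose_spec

lemma exists_adapted_orthonormalBasis (T : Submodule ℝ E) {d m : ℕ}
    (hd : Module.finrank ℝ T = d) (hm : Module.finrank ℝ E = d + m) :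
    ∃ b : OrthonormalBasis (Fin d ⊕ Fin m) ℝ E, ∀ i, b (Sum.inl i) ∈ T := by
  subst hd
  let u := stdOrthonormalBasis ℝ T
  -- The zeros on the right block are placeholders: only the left block is kept by the extension.
  let v : Fin (Module.finrank ℝ T) ⊕ Fin m → E := Sum.elim (fun i => (u i : E)) 0
  have hv : Orthonormal ℝ ((Set.range Sum.inl).domRestrict v) := by
    have hu : Orthonormal ℝ (fun i => (u i : E)) :=
      u.orthonormal.comp_linearIsometry T.subtypeₗᵢ
    constructor
    · rintro ⟨_, i, rfl⟩
      exact hu.1 i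
    · rintro ⟨_, i, rfl⟩ ⟨_, j, rfl⟩ hij
      exact hu.2 (fun h => hij (by rw [h]))
  obtain ⟨b, hb⟩ := hv.exists_orthonormalBasis_extension_of_card_eq (by simp [hm])
  exact ⟨b, fun i => by rw [hb _ ⟨i, rfl⟩]; exact (u i).2⟩

lemma starProjection_sum_adapted (T : Submodule ℝ E) {d m : ℕ}
    (hd : Module.finrank ℝ T = d) (b : OrthonormalBasis (Fin d ⊕ Fin m) ℝ E)
    (hb : ∀ i, b (Sum.inl i) ∈ T) (x : Fin d ⊕ Fin m → ℝ) :
    T.starProjection (∑ i, x i • b i) = ∑ i, x (Sum.inl i) • b (Sum.inl i) := by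
  have hspan : Submodule.span ℝ (Set.range fun i => b (Sum.inl i)) = T := by
    refine Submodule.eq_of_le_of_finrank_eq
      (Submodule.span_le.2 (by rintro _ ⟨i, rfl⟩; exact hb i)) ?_
    rw [show (fun i => b (Sum.inl i)) = b ∘ Sum.inl from rfl, finrank_span_eq_card
      (b.orthonormal.comp Sum.inl Sum.inl_injective).linearIndependent, hd, Fintype.card_fin]
  refine Submodule.eq_starProjection_of_mem_of_inner_eq_zero
    (Submodule.sum_mem _ fun i _ => T.smul_mem _ (hb i)) fun w hw => ?_
  rw [Fintype.sum_sum_type, add_sub_cancel_left]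
  rw [← hspan] at hw
  induction hw using Submodule.span_induction with
  | mem w hw =>
    obtain ⟨j, rfl⟩ := hw
    simp [sum_inner, inner_smul_left, b.inner_eq_ite]
  | zero => simp
  | add w₁ w₂ _ _ h₁ h₂ => rw [inner_add_right, h₁, h₂, add_zero]
  | smul c w _ h => rw [inner_smul_right, h, mul_zero]

variable [MeasurableSpace E] [BorelSpace E]

/-- Cochran's theorem: in an orthonormal basis adapted to `T` the coordinates are i.i.d. standard
Gaussian, and the two squared norms depend on disjoint blocks of them. -/
lemma stdGaussian_map_sq_norm_starProjection (T : Submodule ℝ E) {d m : ℕ}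
    (hd : Module.finrank ℝ T = d) (hm : Module.finrank ℝ E = d + m) :
    (stdGaussian E).map (fun x => (‖T.starProjection x‖ ^ 2, ‖x - T.starProjection x‖ ^ 2)) =
      (chiSquared d).prod (chiSquared m) := by
  obtain ⟨b, hb⟩ := exists_adapted_orthonormalBasis T hd hm
  rw [stdGaussian_eq_map_pi_orthonormalBasis b, Measure.map_map (by fun_prop) (by fun_prop)]
  have hnorm {k : ℕ} (v : Fin k → Fin d ⊕ Fin m) (hv : Function.Injective v) (y : Fin k → ℝ) :
      ‖∑ i, y i • b (v i)‖ ^ 2 = ∑ i, y i ^ 2 := by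
    rw [← real_inner_self_eq_norm_sq]
    refine ((b.orthonormal.comp v hv).inner_sum y y Finset.univ).trans ?_
    simp [sq]
  have hcomp : ((fun x => (‖T.starProjection x‖ ^ 2, ‖x - T.starProjection x‖ ^ 2)) ∘
      fun x : Fin d ⊕ Fin m → ℝ => ∑ i, x i • b i) =
      (Prod.map (fun z : Fin d → ℝ => ∑ i, z i ^ 2) (fun z : Fin m → ℝ => ∑ i, z i ^ 2)) ∘
        MeasurableEquiv.sumPiEquivProdPi (fun _ => ℝ) := by
    funext x
    simp only [Function.comp_apply, starProjection_sum_adapted T hd b hb]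
    rw [Fintype.sum_sum_type, add_sub_cancel_left, hnorm _ Sum.inl_injective (fun i => x (.inl i)),
      hnorm _ Sum.inr_injective (fun i => x (.inr i))]
    rfl
  rw [hcomp, ← Measure.map_map (by fun_prop) (by fun_prop),
    (measurePreserving_sumPiEquivProdPi (fun _ : Fin d ⊕ Fin m => gaussianReal 0 1)).map_eq,
    chiSquared, chiSquared, Measure.map_prod_map _ _ (by fun_prop) (by fun_prop)]

end Geometry

/-! ### Expectations of functionals of the noise. -/

section Noise

variable {n : ℕ} {Ω : Type*} [MeasurableSpace Ω] {μ : Measure Ω}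
  {ε : Ω → EuclideanSpace ℝ (Fin n)} {σ : ℝ}

lemma aemeasurable_noise
    (hlaw : ∀ i, HasLaw (fun ω => ε ω i) (gaussianReal 0 (Real.toNNReal (σ ^ 2))) μ) :
    AEMeasurable ε μ := by
  have h : AEMeasurable (fun ω i => ε ω i) μ :=
    aemeasurable_pi_lambda _ fun i => (hlaw i).aemeasurable
  exact (WithLp.measurable_toLp 2 _).comp_aemeasurable h

variable [IsProbabilityMeasure μ]

lemma map_noise_eq (hσ : 0 < σ)
    (hlaw : ∀ i, HasLaw (fun ω => ε ω i) (gaussianReal 0 (Real.toNNReal (σ ^ 2))) μ)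
    (hind : iIndepFun (fun i ω => ε ω i) μ) :
    μ.map (fun ω => σ⁻¹ • ε ω) = stdGaussian (EuclideanSpace ℝ (Fin n)) := by
  have hm : ∀ i, AEMeasurable (fun ω => σ⁻¹ * ε ω i) μ := fun i => (hlaw i).aemeasurable.const_mul _
  have hind' : iIndepFun (fun i ω => σ⁻¹ * ε ω i) μ :=
    hind.comp (fun _ x => σ⁻¹ * x) fun _ => by fun_prop
  have h := (iIndepFun_iff_map_fun_eq_pi_map hm).1 hind'
  have hone : ∀ i, μ.map (fun ω => σ⁻¹ * ε ω i) = gaussianReal 0 1 := by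
    intro i
    have := AEMeasurable.map_map_of_aemeasurable (μ := μ) (g := fun x : ℝ => σ⁻¹ * x)
      (f := fun ω => ε ω i) (by fun_prop) (hlaw i).aemeasurable
    rw [(hlaw i).map_eq, gaussianReal_map_const_mul] at this
    rw [show (fun ω => σ⁻¹ * ε ω i) = (fun x : ℝ => σ⁻¹ * x) ∘ (fun ω => ε ω i) from rfl, ← this]
    congr 1
    · simp
    · ext
      simp [Real.coe_toNNReal _ (sq_nonneg σ)]
      field_simp
  simp_rw [hone] at h
  rw [← map_pi_eq_stdGaussian, ← h,
    AEMeasurable.map_map_of_aemeasurable (WithLp.measurable_toLp 2 _).aemeasurable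
      (aemeasurable_pi_lambda _ hm)]
  rfl

/-- `(‖Π_T x‖² - a ‖x - Π_T x‖²)₊`. -/
noncomputable def noiseExcess (T : Submodule ℝ (EuclideanSpace ℝ (Fin n))) (a : ℝ)
    (x : EuclideanSpace ℝ (Fin n)) : ℝ :=
  max (‖T.starProjection x‖ ^ 2 - a * ‖x - T.starProjection x‖ ^ 2) 0

lemma measurable_noiseExcess (T : Submodule ℝ (EuclideanSpace ℝ (Fin n))) (a : ℝ) :
    Measurable (noiseExcess T a) := by
  unfold noiseExcess; fun_prop

lemma noiseExcess_smul (T : Submodule ℝ (EuclideanSpace ℝ (Fin n))) (a c : ℝ)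
    (x : EuclideanSpace ℝ (Fin n)) : noiseExcess T a (c • x) = c ^ 2 * noiseExcess T a x := by
  unfold noiseExcess
  rw [map_smul, ← smul_sub, norm_smul, norm_smul, mul_max_of_nonneg _ _ (sq_nonneg c), mul_pow,
    mul_pow, Real.norm_eq_abs, sq_abs]
  ring_nf

/-- After rescaling by `σ⁻¹`, the two squared norms are exactly the `U` and `V` of the equation that
defines the penalty. -/
lemma lintegral_noiseExcess (hσ : 0 < σ)
    (hlaw : ∀ i, HasLaw (fun ω => ε ω i) (gaussianReal 0 (Real.toNNReal (σ ^ 2))) μ)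
    (hind : iIndepFun (fun i ω => ε ω i) μ) (T : Submodule ℝ (EuclideanSpace ℝ (Fin n)))
    {D : ℕ} (hD : D + 2 ≤ n) (hT : Module.finrank ℝ T = D + 1) (x : ℝ) :
    ∫⁻ ω, ENNReal.ofReal (noiseExcess T (x / ((n : ℝ) - D)) (ε ω)) ∂μ =
      ENNReal.ofReal (σ ^ 2 * expectedExcess n D x) := by
  set a := x / ((n : ℝ) - D) with ha
  have hmap := map_noise_eq hσ hlaw hind
  have hmε : AEMeasurable (fun ω => σ⁻¹ • ε ω) μ := (aemeasurable_noise hlaw).fun_const_smul _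
  have hsc : ∀ ω, ENNReal.ofReal (noiseExcess T a (ε ω)) =
      ENNReal.ofReal (σ ^ 2) * ENNReal.ofReal (noiseExcess T a (σ⁻¹ • ε ω)) := by
    intro ω
    rw [← ENNReal.ofReal_mul (sq_nonneg σ), ← noiseExcess_smul, smul_inv_smul₀ hσ.ne']
  simp_rw [hsc]
  rw [lintegral_const_mul' _ _ ENNReal.ofReal_ne_top, ENNReal.ofReal_mul (sq_nonneg σ),
    ← lintegral_map' (f := fun x => ENNReal.ofReal (noiseExcess T a x))
      (measurable_noiseExcess T a).ennreal_ofReal.aemeasurable hmε, hmap]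
  congr 1
  have hchi := stdGaussian_map_sq_norm_starProjection T (m := n - D - 1) hT
    (by rw [finrank_euclideanSpace_fin]; omega)
  unfold expectedExcess
  rw [ofReal_integral_eq_lintegral_ofReal (integrable_excess _ _ _)
    (.of_forall fun p => le_max_right _ _), ← hchi, lintegral_map (by fun_prop) (by fun_prop)]
  rfl

/-- The same Chernoff bound: centering at `2 n` contributes `exp (-n / 2)`, which offsets the
exponential moment `√2 ^ n`. -/
lemma lintegral_sq_norm_noise_sub_le (hσ : 0 < σ)
    (hlaw : ∀ i, HasLaw (fun ω => ε ω i) (gaussianReal 0 (Real.toNNReal (σ ^ 2))) μ)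
    (hind : iIndepFun (fun i ω => ε ω i) μ) :
    ∫⁻ ω, ENNReal.ofReal (max (‖ε ω‖ ^ 2 - 2 * n * σ ^ 2) 0) ∂μ ≤ ENNReal.ofReal (4 * σ ^ 2) := by
  have hmap := map_noise_eq hσ hlaw hind
  have hmε : AEMeasurable (fun ω => σ⁻¹ • ε ω) μ := (aemeasurable_noise hlaw).fun_const_smul _
  -- With `T = ⊤` the first marginal is the law of `‖x‖²`.
  have hchi := stdGaussian_map_sq_norm_starProjection
    (⊤ : Submodule ℝ (EuclideanSpace ℝ (Fin n))) (d := n) (m := 0)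
    (by rw [finrank_top, finrank_euclideanSpace_fin]) (by rw [finrank_euclideanSpace_fin]; rfl)
  have h1 : (1 / 4 : ℝ) < 1 / 2 := by norm_num
  have hb : ∀ ω, ENNReal.ofReal (max (‖ε ω‖ ^ 2 - 2 * n * σ ^ 2) 0) ≤
      ENNReal.ofReal (4 * σ ^ 2 * Real.exp (-(n / 2))) *
        ENNReal.ofReal (Real.exp (1 / 4 * ‖σ⁻¹ • ε ω‖ ^ 2)) := by
    intro ω
    rw [← ENNReal.ofReal_mul (by positivity)]
    apply ENNReal.ofReal_le_ofReal
    have hn : ‖ε ω‖ ^ 2 = σ ^ 2 * ‖σ⁻¹ • ε ω‖ ^ 2 := by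
      rw [norm_smul, norm_inv, Real.norm_eq_abs, mul_pow, inv_pow, sq_abs]
      field_simp
    have h := max_zero_le_exp (‖σ⁻¹ • ε ω‖ ^ 2 - 2 * n)
    calc max (‖ε ω‖ ^ 2 - 2 * n * σ ^ 2) 0 = σ ^ 2 * max (‖σ⁻¹ • ε ω‖ ^ 2 - 2 * n) 0 := by
          rw [mul_max_of_nonneg _ _ (sq_nonneg σ), hn]; ring_nf
      _ ≤ σ ^ 2 * (4 * Real.exp ((‖σ⁻¹ • ε ω‖ ^ 2 - 2 * n) / 4)) := by gcongr
      _ = _ := by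
          rw [mul_assoc (4 * σ ^ 2), ← Real.exp_add]; ring_nf
  refine (lintegral_mono hb).trans ?_
  rw [lintegral_const_mul' _ _ ENNReal.ofReal_ne_top,
    ← lintegral_map' (f := fun x => ENNReal.ofReal (Real.exp (1 / 4 * ‖x‖ ^ 2)))
      (by fun_prop) hmε, hmap]
  have hint : ∫⁻ x : EuclideanSpace ℝ (Fin n), ENNReal.ofReal (Real.exp (1 / 4 * ‖x‖ ^ 2))
      ∂(stdGaussian _) = ENNReal.ofReal (√2 ^ n) := by
    have h2 : √2 ^ n = ∫ u, Real.exp (1 / 4 * u) ∂(chiSquared n) := by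
      rw [integral_exp_mul_chiSquared h1]; norm_num
    rw [h2, ofReal_integral_eq_lintegral_ofReal (integrable_exp_mul_chiSquared h1 n)
      (.of_forall fun p => (Real.exp_pos _).le),
      ← Measure.fst_prod (μ := chiSquared n) (ν := chiSquared 0), ← hchi, Measure.fst]
    rw [lintegral_map (by fun_prop) (by fun_prop), lintegral_map (by fun_prop) (by fun_prop)]
    refine lintegral_congr fun x => ?_
    rw [Submodule.starProjection_eq_self_iff.2 Submodule.mem_top]
  rw [hint, ← ENNReal.ofReal_mul (by positivity)]
  apply ENNReal.ofReal_le_ofReal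
  have hs2 := sqrt_two_le_exp_half
  calc 4 * σ ^ 2 * Real.exp (-(n / 2)) * √2 ^ n
      ≤ 4 * σ ^ 2 * Real.exp (-(n / 2)) * Real.exp (1 / 2) ^ n := by gcongr
    _ = 4 * σ ^ 2 := by
      rw [← Real.exp_nat_mul, mul_assoc, ← Real.exp_add]
      ring_nf
      simp

end Noise

/-! ### Pathwise inequalities for the criterion. -/

section Deterministic

variable {n : ℕ} {S T : Submodule ℝ (EuclideanSpace ℝ (Fin n))} {f e g v : EuclideanSpace ℝ (Fin n)}
  {K a : ℝ}

lemma norm_sub_starProjection_le_of_mem (hv : v ∈ S) (x : EuclideanSpace ℝ (Fin n)) :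
    ‖x - S.starProjection x‖ ≤ ‖x - v‖ := by
  rw [Submodule.starProjection_minimal]
  exact ciInf_le ⟨0, by rintro _ ⟨y, rfl⟩; exact norm_nonneg _⟩ (⟨v, hv⟩ : S)

lemma two_mul_inner_le_of_mem (hK : 0 < K) (hv : v ∈ T) (e : EuclideanSpace ℝ (Fin n)) :
    2 * inner ℝ e v ≤ K⁻¹ * ‖v‖ ^ 2 + K * ‖T.starProjection e‖ ^ 2 := by
  have h : inner ℝ e v = inner ℝ (T.starProjection e) v := by
    rw [Submodule.inner_starProjection_left_eq_right, Submodule.starProjection_eq_self_iff.2 hv]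
  rw [h]
  have h1 := real_inner_le_norm (T.starProjection e) v
  have h2 : 0 ≤ K⁻¹ * (‖v‖ - K * ‖T.starProjection e‖) ^ 2 := by positivity
  have h3 : K⁻¹ * (‖v‖ - K * ‖T.starProjection e‖) ^ 2 =
      K⁻¹ * ‖v‖ ^ 2 + K * ‖T.starProjection e‖ ^ 2 - 2 * (‖T.starProjection e‖ * ‖v‖) := by
    field_simp; ring
  linarith

/-- The vector `Π_S Y - f` lies in `T`, so the unobserved residual `ε - Π_T ε` is no longer than `ε
- (Π_S Y - f) = Y - Π_S Y`, which is observed. -/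
lemma sq_norm_starProjection_le (ha : 0 ≤ a) (hST : S ≤ T) (hf : f ∈ T) :
    ‖T.starProjection e‖ ^ 2 ≤
      a * ‖f + e - S.starProjection (f + e)‖ ^ 2 + noiseExcess T a e := by
  have h1 : ‖e - T.starProjection e‖ ≤ ‖f + e - S.starProjection (f + e)‖ := by
    refine (norm_sub_starProjection_le_of_mem
      (T.sub_mem (hST (S.starProjection_apply_mem (f + e))) hf) e).trans_eq ?_
    congr 1; abel
  have h2 : ‖T.starProjection e‖ ^ 2 - a * ‖e - T.starProjection e‖ ^ 2 ≤ noiseExcess T a e :=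
    le_max_left _ _
  have h3 : a * ‖e - T.starProjection e‖ ^ 2 ≤ a * ‖f + e - S.starProjection (f + e)‖ ^ 2 := by
    gcongr
  linarith

/-- Since `K > 1`, a fraction `1 - K⁻¹` of `‖Π_S g - f‖²` survives the cross term; the `α` term
supplies `‖g - Π_S g‖²`, and together they control `‖f - g‖²`. -/
lemma le_penalized_criterion {α : ℝ} (hK : 1 < K) (hα : 0 < α) (ha : 0 ≤ a) (hST : S ≤ T)
    (hf : f ∈ T) :
    min (1 - K⁻¹) α / 2 * ‖f - g‖ ^ 2 + ‖e‖ ^ 2 ≤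
      ‖f + e - S.starProjection g‖ ^ 2 + α * ‖g - S.starProjection g‖ ^ 2 +
        K * (a * ‖f + e - S.starProjection (f + e)‖ ^ 2) + K * noiseExcess T a e := by
  set p := S.starProjection g with hp
  have hmem : p - f ∈ T := T.sub_mem (hST (S.starProjection_apply_mem g)) hf
  have h1 := two_mul_inner_le_of_mem (by linarith : 0 < K) hmem e
  have h2 := mul_le_mul_of_nonneg_left (sq_norm_starProjection_le (e := e) ha hST hf)
    (by linarith : 0 ≤ K)
  have h3 : ‖f + e - p‖ ^ 2 = ‖p - f‖ ^ 2 - 2 * inner ℝ e (p - f) + ‖e‖ ^ 2 := by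
    rw [show f + e - p = e - (p - f) by abel, norm_sub_sq_real]; ring
  have h4 : ‖f - g‖ ^ 2 ≤ 2 * (‖p - f‖ ^ 2 + ‖g - p‖ ^ 2) := by
    have : ‖f - g‖ ≤ ‖p - f‖ + ‖g - p‖ := by
      rw [norm_sub_rev, show g - f = (p - f) + (g - p) by abel]
      exact norm_add_le _ _
    nlinarith [norm_nonneg (f - g), sq_nonneg (‖p - f‖ - ‖g - p‖)]
  have hKi : K⁻¹ < 1 := inv_lt_one_of_one_lt₀ hK
  have hc : 0 < min (1 - K⁻¹) α := lt_min (by linarith) hα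
  have h5 : min (1 - K⁻¹) α * ‖p - f‖ ^ 2 ≤ (1 - K⁻¹) * ‖p - f‖ ^ 2 := by
    gcongr; exact min_le_left _ _
  have h6 : min (1 - K⁻¹) α * ‖g - p‖ ^ 2 ≤ α * ‖g - p‖ ^ 2 := by
    gcongr; exact min_le_right _ _
  have h7 := mul_le_mul_of_nonneg_left h4 hc.le
  linarith

lemma penalized_criterion_le (hK : 1 < K) (ha : 0 ≤ a) (hST : S ≤ T) (hf : f ∈ T) (hg : g ∈ S) :
    ‖f + e - g‖ ^ 2 + K * (a * ‖f + e - S.starProjection (f + e)‖ ^ 2) ≤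
      ‖e‖ ^ 2 + 2 * ‖f - g‖ ^ 2 + 2 * K * (a * ‖f + e - S.starProjection (f + e)‖ ^ 2) +
        K * noiseExcess T a e := by
  have h1 := two_mul_inner_le_of_mem (by linarith : 0 < K) (T.sub_mem hf (hST hg)) e
  have h2 := mul_le_mul_of_nonneg_left (sq_norm_starProjection_le (e := e) ha hST hf)
    (by linarith : 0 ≤ K)
  have h3 : ‖f + e - g‖ ^ 2 = ‖f - g‖ ^ 2 + 2 * inner ℝ e (f - g) + ‖e‖ ^ 2 := by
    rw [show f + e - g = e + (f - g) by abel, norm_add_sq_real]; ring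
  have h4 : K⁻¹ * ‖f - g‖ ^ 2 ≤ 1 * ‖f - g‖ ^ 2 := by
    gcongr; exact inv_le_one_of_one_le₀ hK.le
  linarith

/-- `x / N` is of order `M / n`. This factor turns the bulk `2 n σ²` of `‖ε‖²` into `2 M σ²`, and it
is at most `1` on the remaining terms. -/
lemma residual_le {A κ M N σ : ℝ} (hA : 0 ≤ A) (hκ : κ ∈ Set.Ioo (0 : ℝ) 1) (hM : 0 ≤ M)
    (hn : 0 < n) (hMκ : M ≤ κ * n) (hN : (1 - κ) * n ≤ N) {x : ℝ} (hx : x ≤ A * M)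
    (hg : g ∈ S) :
    x / N * ‖f + e - S.starProjection (f + e)‖ ^ 2 ≤
      2 * A / (1 - κ) * (‖f - g‖ ^ 2 + 2 * (M * σ ^ 2) + max (‖e‖ ^ 2 - 2 * n * σ ^ 2) 0) := by
  obtain ⟨hκ0, hκ1⟩ := hκ
  have hn' : (0 : ℝ) < n := by exact_mod_cast hn
  have h1κ : 0 < 1 - κ := by linarith
  set R := max (‖e‖ ^ 2 - 2 * n * σ ^ 2) 0
  have hR0 : 0 ≤ R := le_max_right _ _
  have hR : ‖e‖ ^ 2 ≤ 2 * n * σ ^ 2 + R := by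
    linarith [le_max_left (‖e‖ ^ 2 - 2 * n * σ ^ 2) 0]
  have h1 : ‖f + e - S.starProjection (f + e)‖ ^ 2 ≤ 2 * (‖f - g‖ ^ 2 + ‖e‖ ^ 2) := by
    have h := norm_sub_starProjection_le_of_mem hg (f + e)
    have : ‖f + e - g‖ ≤ ‖f - g‖ + ‖e‖ := by
      rw [show f + e - g = (f - g) + e by abel]
      exact norm_add_le _ _
    nlinarith [norm_nonneg (f + e - S.starProjection (f + e)), sq_nonneg (‖f - g‖ - ‖e‖)]
  have h2 : x / N ≤ A / (1 - κ) * (M / n) := by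
    rw [div_mul_div_comm]
    have : 0 < (1 - κ) * n := by positivity
    calc x / N ≤ A * M / N := by gcongr; linarith
      _ ≤ _ := by gcongr
  have h3 : M / n ≤ κ := (div_le_iff₀ hn').2 hMκ
  have h3' : 0 ≤ M / n := by positivity
  have h4 : M / n * (‖f - g‖ ^ 2 + ‖e‖ ^ 2) ≤ ‖f - g‖ ^ 2 + 2 * (M * σ ^ 2) + R := by
    calc M / n * (‖f - g‖ ^ 2 + ‖e‖ ^ 2)
        ≤ M / n * (‖f - g‖ ^ 2 + (2 * n * σ ^ 2 + R)) := by gcongr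
      _ = M / n * ‖f - g‖ ^ 2 + 2 * (M * σ ^ 2) + M / n * R := by field_simp; ring
      _ ≤ 1 * ‖f - g‖ ^ 2 + 2 * (M * σ ^ 2) + 1 * R := by gcongr <;> linarith
      _ = _ := by ring
  calc _ ≤ A / (1 - κ) * (M / n) * (2 * (‖f - g‖ ^ 2 + ‖e‖ ^ 2)) := by gcongr
    _ = 2 * A / (1 - κ) * (M / n * (‖f - g‖ ^ 2 + ‖e‖ ^ 2)) := by ring
    _ ≤ _ := by gcongr

end Deterministic

lemma sq_enorm_eq_ofReal {E : Type*} [SeminormedAddCommGroup E] (x : E) :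
    ‖x‖ₑ ^ 2 = ENNReal.ofReal (‖x‖ ^ 2) := by
  rw [ENNReal.ofReal_pow (norm_nonneg x), ofReal_norm]

end EstimatorSelection

/-! ### The risk bound. -/

open EstimatorSelection in
theorem corollary1 (K α κ : ℝ) (hK : 1 < K) (hα : 0 < α) (hκ : κ ∈ Set.Ioo (0 : ℝ) 1) :
    -- the constant depends on `K`, `α` and `κ` only
    ∃ C : ℝ, 0 < C ∧
      ∀ (n : ℕ)
        -- the Gaussian regression model: `Y i = f i + ε i`, with `ε i` i.i.d. `N(0, σ²)`
        (f : EuclideanSpace ℝ (Fin n)) (σ : ℝ) (_ : 0 < σ)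
        (Ω : Type*) (_ : MeasurableSpace Ω) (μ : Measure Ω) (_ : IsProbabilityMeasure μ)
        (ε Y : Ω → EuclideanSpace ℝ (Fin n))
        (_ : ∀ i, HasLaw (fun ω => ε ω i) (gaussianReal 0 (Real.toNNReal (σ ^ 2))) μ)
        (_ : iIndepFun (fun i ω => ε ω i) μ)
        (_ : ∀ ω, Y ω = f + ε ω)
        -- the family of linear spaces: countable, of dimension at most `n - 2`
        (𝕊 : Set (Submodule ℝ (EuclideanSpace ℝ (Fin n))))
        (_ : 𝕊.Countable)
        (_ : ∀ S ∈ 𝕊, Module.finrank ℝ S + 2 ≤ n)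
        -- the weight function, with `∑ exp (-Δ S)` finite and `1 ≤ dim S ∨ Δ S ≤ κ n`
        (Δ : Submodule ℝ (EuclideanSpace ℝ (Fin n)) → ℝ)
        (_ : ∀ S ∈ 𝕊, 0 ≤ Δ S)
        (_ : Summable (fun S : 𝕊 => Real.exp (-Δ S)))
        (_ : ∀ S ∈ 𝕊, 1 ≤ EstimatorSelection.dimOrWeight Δ S ∧
          EstimatorSelection.dimOrWeight Δ S ≤ κ * n)
        -- the penalty
        (pen : Submodule ℝ (EuclideanSpace ℝ (Fin n)) → ℝ)
        (_ : ∀ S ∈ 𝕊, pen S = K * EstimatorSelection.penDelta n (Module.finrank ℝ S) (Δ S))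
        -- the estimators, their (random) collections of linear spaces, and the random spaces `Ŝ l`
        (Λ : Type*) (fhat : Λ → Ω → EuclideanSpace ℝ (Fin n))
        (_ : ∀ l, AEMeasurable (fhat l) μ)
        (𝕊l : Λ → Ω → Set (Submodule ℝ (EuclideanSpace ℝ (Fin n))))
        (_ : ∀ l ω, 𝕊l l ω ⊆ 𝕊)
        (Shat : Λ → Ω → Submodule ℝ (EuclideanSpace ℝ (Fin n)))
        (_ : ∀ l, ∀ S ∈ 𝕊, NullMeasurableSet {ω | Shat l ω = S} μ)
        (_ : ∀ l, ∀ᵐ ω ∂μ, Shat l ω ∈ 𝕊l l ω ∧ fhat l ω ∈ Shat l ω)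
        -- the selected estimator
        (δ : ℝ) (_ : 0 ≤ δ) (lhat : Ω → Λ)
        (_ : AEMeasurable (fun ω => fhat (lhat ω) ω) μ)
        (_ : ∀ᵐ ω ∂μ,
          EstimatorSelection.crit α pen (𝕊l (lhat ω) ω) (Y ω) (fhat (lhat ω) ω) ≤
            (⨅ l, EstimatorSelection.crit α pen (𝕊l l ω) (Y ω) (fhat l ω)) + ENNReal.ofReal δ),
        ENNReal.ofReal (C / (1 + ∑' S : 𝕊, Real.exp (-Δ S))) *
            ∫⁻ ω, ‖f - fhat (lhat ω) ω‖ₑ ^ 2 ∂μ ≤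
          (⨅ l, ((∫⁻ ω, ‖f - fhat l ω‖ₑ ^ 2 ∂μ) +
            (∫⁻ ω, ENNReal.ofReal (EstimatorSelection.dimOrWeight Δ (Shat l ω)) ∂μ) *
              ENNReal.ofReal (σ ^ 2))) + ENNReal.ofReal δ := by
  have hA : 0 ≤ penConst κ := by unfold penConst; positivity
  have hK0 : 0 < K := by linarith
  have h1κ : 0 < 1 - κ := by linarith [hκ.2]
  set B := 2 * penConst κ / (1 - κ) with hB
  have hB0 : 0 ≤ B := by positivity
  set c := min (1 - K⁻¹) α / 2 with hc
  have hc0 : 0 < c := by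
    have := inv_lt_one_of_one_lt₀ hK
    exact half_pos (lt_min (by linarith) hα)
  -- Chosen so that `G * (1 + s)` dominates the final coefficients `2 + 2KB`, `12KB + 2Ks` and `1`
  -- of the risk, the complexity term and `δ`.
  set G := 2 + 2 * K + 12 * K * B with hG
  have hG0 : 0 < G := by positivity
  refine ⟨c / G, by positivity, ?_⟩
  intro n f σ hσ Ω _ μ _ ε Y hlaw hind hY 𝕊 hcount hdim Δ hΔ hsum hM pen hpen Λ fhat hfm 𝕊l h𝕊l
    Shat _ hShat δ hδ lhat hlm hlhat
  set s := ∑' S : 𝕊, Real.exp (-Δ S) with hs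
  have hs0 : 0 ≤ s := tsum_nonneg fun _ => (Real.exp_pos _).le
  have : Countable 𝕊 := hcount
  let pd : Submodule ℝ (EuclideanSpace ℝ (Fin n)) → ℝ :=
    fun S => penDelta n (Module.finrank ℝ S) (Δ S)
  let a : Submodule ℝ (EuclideanSpace ℝ (Fin n)) → ℝ :=
    fun S => pd S / ((n : ℝ) - Module.finrank ℝ S)
  have hpd : ∀ S ∈ 𝕊, 0 ≤ pd S ∧ pd S ≤ penConst κ * dimOrWeight Δ S ∧
      expectedExcess n (Module.finrank ℝ S) (pd S) = Real.exp (-Δ S) := fun S hS =>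
    penDelta_spec hκ (hdim S hS) (hΔ S hS) (hM S hS).1 (hM S hS).2
  have hdim' : ∀ S ∈ 𝕊, (Module.finrank ℝ S : ℝ) + 2 ≤ n := fun S hS => by
    exact_mod_cast hdim S hS
  have ha0 : ∀ S ∈ 𝕊, 0 ≤ a S := fun S hS =>
    div_nonneg (hpd S hS).1 (by linarith [hdim' S hS])
  have hext : ∀ S ∈ 𝕊, S ≤ extend S f ∧ f ∈ extend S f ∧
      Module.finrank ℝ (extend S f) = Module.finrank ℝ S + 1 := fun S hS =>
    extend_spec f (by rw [finrank_euclideanSpace_fin]; linarith [hdim S hS])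
  have hpensig : ∀ S ∈ 𝕊, ∀ y, pen S * sigmaHatSq S y =
      K * (a S * ‖y - S.starProjection y‖ ^ 2) := by
    intro S hS y
    simp only [hpen S hS, sigmaHatSq, a, pd]
    ring
  let q : 𝕊 → Ω → ℝ≥0∞ := fun S ω => ENNReal.ofReal (noiseExcess (extend S.1 f) (a S) (ε ω))
  have hqm : ∀ S, AEMeasurable (q S) μ := fun S =>
    ((measurable_noiseExcess _ _).comp_aemeasurable (aemeasurable_noise hlaw)).ennreal_ofReal
  -- The sum over all of `𝕊` dominates the excess of whichever space is chosen at random.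
  let Q : Ω → ℝ≥0∞ := fun ω => ENNReal.ofReal K * ∑' S, q S ω
  have hQm : AEMeasurable Q μ := (AEMeasurable.tsum hqm).const_mul _
  have hQint : ∫⁻ ω, Q ω ∂μ = ENNReal.ofReal (K * s * σ ^ 2) := by
    rw [lintegral_const_mul' _ _ ENNReal.ofReal_ne_top, lintegral_tsum hqm]
    have h : ∀ S : 𝕊, ∫⁻ ω, q S ω ∂μ = ENNReal.ofReal (σ ^ 2 * Real.exp (-Δ S)) := fun S => by
      rw [← (hpd S S.2).2.2]
      exact lintegral_noiseExcess hσ hlaw hind _ (hdim S S.2) (hext S S.2).2.2 _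
    simp_rw [h]
    rw [← ENNReal.ofReal_tsum_of_nonneg (fun S => by positivity) (hsum.mul_left _), tsum_mul_left,
      ← ENNReal.ofReal_mul hK0.le]
    congr 1; ring
  have hleQ : ∀ S ∈ 𝕊, ∀ ω,
      ENNReal.ofReal (K * noiseExcess (extend S f) (a S) (ε ω)) ≤ Q ω := by
    intro S hS ω
    rw [ENNReal.ofReal_mul hK0.le]
    exact mul_le_mul_right (ENNReal.le_tsum (f := fun S => q S ω) ⟨S, hS⟩) _
  let R : Ω → ℝ := fun ω => max (‖ε ω‖ ^ 2 - 2 * n * σ ^ 2) 0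
  have hRm : AEMeasurable (fun ω => ENNReal.ofReal (R ω)) μ :=
    ((((aemeasurable_noise hlaw).norm.pow_const 2).sub_const _).max
      aemeasurable_const).ennreal_ofReal
  rw [ENNReal.iInf_add]
  refine le_iInf fun l => ?_
  have hpoint : ∀ᵐ ω ∂μ, ENNReal.ofReal c * ‖f - fhat (lhat ω) ω‖ₑ ^ 2 ≤
      ENNReal.ofReal (2 + 2 * K * B) * ‖f - fhat l ω‖ₑ ^ 2 +
      (ENNReal.ofReal (2 * K * B) * ENNReal.ofReal (R ω) + (Q ω + (Q ω + (ENNReal.ofReal δ +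
        ENNReal.ofReal (4 * K * B * σ ^ 2) * ENNReal.ofReal (dimOrWeight Δ (Shat l ω)))))) := by
    filter_upwards [hlhat, hShat l] with ω h1 h2
    obtain ⟨hSl, hfS⟩ := h2
    have hS := h𝕊l l ω hSl
    set S := Shat l ω with hSdef
    have hlow : ENNReal.ofReal (c * ‖f - fhat (lhat ω) ω‖ ^ 2 + ‖ε ω‖ ^ 2) ≤
        crit α pen (𝕊l (lhat ω) ω) (Y ω) (fhat (lhat ω) ω) + Q ω := by
      -- Moving `Q` to the left isolates the infimum, so each space can be treated separately.
      rw [← tsub_le_iff_right]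
      refine le_iInf₂ fun S' hS' => ?_
      have hS' := h𝕊l _ _ hS'
      rw [tsub_le_iff_right]
      refine le_trans ?_ (add_le_add_right (hleQ S' hS' ω) _)
      have hn0 : 0 ≤ noiseExcess (extend S' f) (a S') (ε ω) := le_max_right _ _
      rw [hpensig S' hS', hY, ← ENNReal.ofReal_add
        (by have := ha0 S' hS'; positivity) (by positivity)]
      exact ENNReal.ofReal_le_ofReal
        (le_penalized_criterion hK hα (ha0 S' hS') (hext S' hS').1 (hext S' hS').2.1)
    have hupp : crit α pen (𝕊l l ω) (Y ω) (fhat l ω) ≤ ENNReal.ofReal (‖ε ω‖ ^ 2 +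
        ((2 + 2 * K * B) * ‖f - fhat l ω‖ ^ 2 + 2 * K * B * R ω +
          4 * K * B * σ ^ 2 * dimOrWeight Δ S)) + Q ω := by
      refine (iInf₂_le S hSl).trans ?_
      refine le_trans ?_ (add_le_add_right (hleQ S hS ω) _)
      have hn0 : 0 ≤ noiseExcess (extend S f) (a S) (ε ω) := le_max_right _ _
      have hR0 : 0 ≤ R ω := le_max_right _ _
      have hM0 : 0 ≤ dimOrWeight Δ S := by linarith [(hM S hS).1]
      rw [← ENNReal.ofReal_add (by positivity) (by positivity)]
      apply ENNReal.ofReal_le_ofReal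
      rw [hpensig S hS, hY, Submodule.starProjection_eq_self_iff.2 hfS, sub_self, norm_zero]
      have h3 := penalized_criterion_le (e := ε ω) hK (ha0 S hS) (hext S hS).1 (hext S hS).2.1 hfS
      have hdM : (Module.finrank ℝ S : ℝ) ≤ dimOrWeight Δ S := le_max_left _ _
      have h4 := residual_le (f := f) (e := ε ω) (σ := σ) (N := (n : ℝ) - Module.finrank ℝ S)
        hA hκ hM0 (by linarith [hdim S hS]) (hM S hS).2 (by linarith [(hM S hS).2])
        (hpd S hS).2.1 hfS
      have h5 := mul_le_mul_of_nonneg_left h4 (by positivity : 0 ≤ 2 * K)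
      simp only [a, R] at h3 h5 ⊢
      rw [← hB] at h5
      linarith
    have hall := hlow.trans (add_le_add_left (h1.trans
      (add_le_add_left ((iInf_le _ l).trans hupp) _)) _)
    have hR0 : 0 ≤ R ω := le_max_right _ _
    have hM0 : 0 ≤ dimOrWeight Δ S := by linarith [(hM S hS).1]
    -- The common term `‖ε ω‖²` is finite, hence cancels in `[0, ∞]`.
    rw [add_comm (c * _), ENNReal.ofReal_add (by positivity) (by positivity),
      ENNReal.ofReal_add (p := ‖ε ω‖ ^ 2) (by positivity) (by positivity), add_assoc, add_assoc,
      add_assoc, ENNReal.add_le_add_iff_left ENNReal.ofReal_ne_top, ENNReal.ofReal_add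
      (by positivity) (by positivity), ENNReal.ofReal_add (by positivity) (by positivity),
      ENNReal.ofReal_mul hc0.le, ENNReal.ofReal_mul (p := 2 + 2 * K * B) (by positivity),
      ENNReal.ofReal_mul (p := 2 * K * B) (by positivity),
      ENNReal.ofReal_mul (p := 4 * K * B * σ ^ 2) (by positivity)] at hall
    rw [sq_enorm_eq_ofReal, sq_enorm_eq_ofReal]
    refine hall.trans_eq ?_
    ring
  set X := ∫⁻ ω, ‖f - fhat l ω‖ₑ ^ 2 ∂μ with hX
  set Z := ∫⁻ ω, ENNReal.ofReal (dimOrWeight Δ (Shat l ω)) ∂μ with hZ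
  -- This is what lets `Z σ²` absorb the terms that are bare multiples of `σ²`.
  have hZ1 : 1 ≤ Z := by
    calc (1 : ℝ≥0∞) = ∫⁻ _, 1 ∂μ := by simp
      _ ≤ Z := by
        refine lintegral_mono_ae ?_
        filter_upwards [hShat l] with ω h
        exact ENNReal.one_le_ofReal.2 (hM _ (h𝕊l _ _ h.1)).1
  have hint : ENNReal.ofReal c * ∫⁻ ω, ‖f - fhat (lhat ω) ω‖ₑ ^ 2 ∂μ ≤
      ENNReal.ofReal (2 + 2 * K * B) * X + (ENNReal.ofReal (2 * K * B) * ENNReal.ofReal (4 * σ ^ 2)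
      + (ENNReal.ofReal (K * s * σ ^ 2) + (ENNReal.ofReal (K * s * σ ^ 2) + (ENNReal.ofReal δ +
        ENNReal.ofReal (4 * K * B * σ ^ 2) * Z)))) := by
    rw [← lintegral_const_mul' _ _ ENNReal.ofReal_ne_top]
    refine (lintegral_mono_ae hpoint).trans ?_
    rw [lintegral_add_left' ((((hfm l).const_sub f).enorm.pow_const 2).const_mul _),
      lintegral_add_left' (hRm.const_mul _), lintegral_add_left' hQm, lintegral_add_left' hQm,
      lintegral_add_left' aemeasurable_const, hQint, lintegral_const_mul' _ _ ENNReal.ofReal_ne_top,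
      lintegral_const_mul' _ _ ENNReal.ofReal_ne_top,
      lintegral_const_mul' _ _ ENNReal.ofReal_ne_top, lintegral_const, measure_univ, mul_one]
    gcongr
    exact lintegral_sq_norm_noise_sub_le hσ hlaw hind
  have hfin : ENNReal.ofReal c * ∫⁻ ω, ‖f - fhat (lhat ω) ω‖ₑ ^ 2 ∂μ ≤
      ENNReal.ofReal (G * (1 + s)) * (X + Z * ENNReal.ofReal (σ ^ 2) + ENNReal.ofReal δ) := by
    refine hint.trans ?_
    have hKs : 0 ≤ K * s := by positivity
    have hKB : 0 ≤ K * B := by positivity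
    have hKBs : 0 ≤ K * B * s := by positivity
    have hsplit : ENNReal.ofReal (2 * K * B) * ENNReal.ofReal (4 * σ ^ 2) +
        (ENNReal.ofReal (K * s * σ ^ 2) + ENNReal.ofReal (K * s * σ ^ 2)) ≤
        ENNReal.ofReal (8 * K * B + 2 * K * s) * (Z * ENNReal.ofReal (σ ^ 2)) := by
      rw [← ENNReal.ofReal_mul (by positivity), ← ENNReal.ofReal_add (by positivity)
        (by positivity), ← ENNReal.ofReal_add (by positivity) (by positivity)]
      calc _ = ENNReal.ofReal (8 * K * B + 2 * K * s) * (1 * ENNReal.ofReal (σ ^ 2)) := by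
            rw [one_mul, ← ENNReal.ofReal_mul (by positivity)]
            congr 1; ring
        _ ≤ _ := by gcongr
    calc _ = ENNReal.ofReal (2 + 2 * K * B) * X + ENNReal.ofReal δ +
          (ENNReal.ofReal (2 * K * B) * ENNReal.ofReal (4 * σ ^ 2) +
        (ENNReal.ofReal (K * s * σ ^ 2) + ENNReal.ofReal (K * s * σ ^ 2))) +
          ENNReal.ofReal (4 * K * B) * (Z * ENNReal.ofReal (σ ^ 2)) := by
          rw [ENNReal.ofReal_mul (p := 4 * K * B) (by positivity)]; ring
      _ ≤ ENNReal.ofReal (2 + 2 * K * B) * X + ENNReal.ofReal δ +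
          ENNReal.ofReal (8 * K * B + 2 * K * s) * (Z * ENNReal.ofReal (σ ^ 2)) +
          ENNReal.ofReal (4 * K * B) * (Z * ENNReal.ofReal (σ ^ 2)) := by gcongr
      _ = ENNReal.ofReal (2 + 2 * K * B) * X +
          ENNReal.ofReal (12 * K * B + 2 * K * s) * (Z * ENNReal.ofReal (σ ^ 2)) +
          ENNReal.ofReal 1 * ENNReal.ofReal δ := by
          rw [show 12 * K * B + 2 * K * s = (8 * K * B + 2 * K * s) + 4 * K * B by ring,
            ENNReal.ofReal_add (p := 8 * K * B + 2 * K * s) (by positivity) (by positivity),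
            ENNReal.ofReal_one]
          ring
      _ ≤ ENNReal.ofReal (G * (1 + s)) * X +
          ENNReal.ofReal (G * (1 + s)) * (Z * ENNReal.ofReal (σ ^ 2)) +
          ENNReal.ofReal (G * (1 + s)) * ENNReal.ofReal δ := by
          gcongr <;> rw [hG] <;> nlinarith
      _ = _ := by ring
  have hpos : 0 < G * (1 + s) := by positivity
  calc ENNReal.ofReal (c / G / (1 + s)) * ∫⁻ ω, ‖f - fhat (lhat ω) ω‖ₑ ^ 2 ∂μ
      = ENNReal.ofReal (G * (1 + s))⁻¹ *
        (ENNReal.ofReal c * ∫⁻ ω, ‖f - fhat (lhat ω) ω‖ₑ ^ 2 ∂μ) := by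
        rw [← mul_assoc, ← ENNReal.ofReal_mul (by positivity)]
        congr 2; field_simp
    _ ≤ ENNReal.ofReal (G * (1 + s))⁻¹ * (ENNReal.ofReal (G * (1 + s)) *
        (X + Z * ENNReal.ofReal (σ ^ 2) + ENNReal.ofReal δ)) := by gcongr
    _ = _ := by
        rw [← mul_assoc, ← ENNReal.ofReal_mul (by positivity), inv_mul_cancel₀ hpos.ne',
          ENNReal.ofReal_one, one_mul]
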